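/- Permutations $\sigma\in S_n$ are written in one-line notation $\sigma=\sigma_1\cdots\sigma_n$. Let $\mathrm{des}(\sigma)=|\{i:1\le i<n,\ \sigma_i>\sigma_{i+1}\}|$ and $\mathrm{inv}(\sigma)=|\{(i,j):1\le i<j\le n,\ \sigma_i>\sigma_j\}|$. For a word $w$ of $m$ distinct integers, $\mathrm{red}(w)\in S_m$ is obtained by replacing the $i$-th smallest letter of $w$ by $i$ for each $i$. For $\tau\in S_p$ and $\sigma\in S_n$, a $\tau$-match in $\sigma$ is a position $i$ with $1\le i\le n-p+1$ and $\mathrm{red}(\sigma_i\sigma_{i+1}\cdots\sigma_{i+p-1})=\tau$; let $\tau\text{-mch}(\sigma)$ be the number of $\tau$-matches in $\sigma$. A permutation $\tau\in S_p$ with $p\ge 3$ is minimal overlapping if the smallest $n$ such that some $\sigma\in S_n$ has $\tau\text{-mch}(\sigma)=2$ is $2p-1$. Permutations $\alpha,\beta\in S_p$ are mutually minimal overlapping if both are minimal overlapping and the smallest $n$ such that some $\sigma\in S_n$ has $\alpha\text{-mch}(\sigma)\ge1$ and $\beta\text{-mch}(\sigma)\ge1$ is $2p-1$. For $\Gamma\subseteq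 S_p$ let $\mathcal{NM}_n(\Gamma)$ be the set of $\sigma\in S_n$ that have no $\tau$-match for any $\tau\in\Gamma$. Let $q,z$ be indeterminates over $\mathbb{Q}$, let $[n]_q=1+q+\cdots+q^{n-1}$, $[n]_q!=[1]_q[2]_q\cdots[n]_q$, and $\begin{bmatrix}n\\k\end{bmatrix}_q=\frac{[n]_q!}{[k]_q!\,[n-k]_q!}$ for $0\le k\le n$. Let $$\mathrm{INM}_\Gamma(t,q,z)=1+\sum_{n\ge1}\frac{t^n}{[n]_q!}\sum_{\sigma\in\mathcal{NM}_n(\Gamma)}z^{\mathrm{des}(\sigma)+1}q^{\mathrm{inv}(\sigma)}\in\mathbb{Q}(q,z)[[t]],$$ and define $\mathrm{IU}_{\Gamma,n}(q,z)$ for $n\ge1$ as $[n]_q!$ times the coefficient of $t^n$ in the multiplicative inverse of this power series. **Theorem.** Let $\Gamma=\{\alpha^{(1)},\dots,\alpha^{(k)}\}\subseteq S_p$ be a set of $k$ minimal overlapping permutations which all start with $1$, such that $\alpha^{(i)}$ and $\alpha^{(j)}$ are mutually minimal overlapping for all $1\le i<j\le k$. Let $s_i$ be the last letter of $\alpha^{(i)}$.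 Then $$\mathrm{INM}_\Gamma(t,q,z)=\frac{1}{\mathrm{IU}_\Gamma(t,q,z)},\qquad\text{where}\qquad \mathrm{IU}_\Gamma(t,q,z)=1+\sum_{n\ge1}\mathrm{IU}_{\Gamma,n}(q,z)\frac{t^n}{[n]_q!},$$ $\mathrm{IU}_{\Gamma,1}(q,z)=-z$, and for all $n\ge2$ $$\mathrm{IU}_{\Gamma,n}(q,z)=(1-z)\,\mathrm{IU}_{\Gamma,n-1}(q,z)-\sum_{i=1}^k z^{\mathrm{des}(\alpha^{(i)})}q^{\mathrm{inv}(\alpha^{(i)})}\begin{bmatrix}n-s_i\\p-s_i\end{bmatrix}_q\mathrm{IU}_{\Gamma,n-p+1}(q,z),$$ where the sum over $i$ is read as $0$ if $n<p$. -/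

import Mathlib

/-! Permutations in `S_n` are elements of `Equiv.Perm (Fin n)`.  Positions and letters are counted
from `0`, so that the letter `σ_i` of the one-line notation is `σ (i - 1) + 1`. -/

namespace ConsecutivePattern

open Finset

/-- The reduction of a word of distinct letters: the letter at each position is replaced by its
rank among the letters of the word (the smallest letter gets rank `0`). -/
def red {m : ℕ} (w : Fin m → ℕ) (a : Fin m) : ℕ :=
  #{b : Fin m | w b < w a}

/-- There is a `τ`-match in `σ` starting in position `i`: the factor of `σ` of length `p` that
starts in position `i` exists and its reduction is `τ`. -/
def IsMatch {p n : ℕ} (τ : Equiv.Perm (Fin p)) (σ : Equiv.Perm (Fin n)) (i : Fin n) : Prop :=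
  ∃ h : (i : ℕ) + p ≤ n, ∀ a : Fin p,
    red (fun b : Fin p => (σ ⟨(i : ℕ) + b, by omega⟩ : ℕ)) a = (τ a : ℕ)

instance {p n : ℕ} (τ : Equiv.Perm (Fin p)) (σ : Equiv.Perm (Fin n)) (i : Fin n) :
    Decidable (IsMatch τ σ i) := by
  unfold IsMatch
  infer_instance

/-- The number of `τ`-matches of `σ`. -/
def mch {p n : ℕ} (τ : Equiv.Perm (Fin p)) (σ : Equiv.Perm (Fin n)) : ℕ :=
  #{i : Fin n | IsMatch τ σ i}

/-- `τ ∈ S_p`, `p ≥ 3`, is minimal overlapping: the smallest `n` for which some `σ ∈ S_n` has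
exactly two `τ`-matches is `2 p - 1`. -/
def MinimalOverlapping {p : ℕ} (τ : Equiv.Perm (Fin p)) : Prop :=
  3 ≤ p ∧ IsLeast {n : ℕ | ∃ σ : Equiv.Perm (Fin n), mch τ σ = 2} (2 * p - 1)

/-- `α, β ∈ S_p` are mutually minimal overlapping: both are minimal overlapping and the smallest
`n` for which some `σ ∈ S_n` has both an `α`-match and a `β`-match is `2 p - 1`. -/
def MutuallyMinimalOverlapping {p : ℕ} (α β : Equiv.Perm (Fin p)) : Prop :=
  MinimalOverlapping α ∧ MinimalOverlapping β ∧
    IsLeast {n : ℕ | ∃ σ : Equiv.Perm (Fin n), 1 ≤ mch α σ ∧ 1 ≤ mch β σ} (2 * p - 1)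

/-- The one-line notation of `τ` starts with the letter `1` (which is `0` in `Fin p`). -/
def StartsWithOne {p : ℕ} (τ : Equiv.Perm (Fin p)) : Prop :=
  ∃ h : 0 < p, (τ ⟨0, h⟩ : ℕ) = 0

/-- The last letter of the one-line notation of `τ`, an element of `{1, …, p}`
(and `0` for the empty permutation). -/
def lastLetter {p : ℕ} (τ : Equiv.Perm (Fin p)) : ℕ :=
  if h : 0 < p then (τ ⟨p - 1, by omega⟩ : ℕ) + 1 else 0

/-- The number of descents. -/
def des {n : ℕ} (σ : Equiv.Perm (Fin n)) : ℕ :=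
  #{i : Fin n | ∃ h : (i : ℕ) + 1 < n, σ ⟨(i : ℕ) + 1, h⟩ < σ i}

/-- The number of inversions. -/
def inv {n : ℕ} (σ : Equiv.Perm (Fin n)) : ℕ :=
  #{x : Fin n × Fin n | x.1 < x.2 ∧ σ x.2 < σ x.1}

/-- The permutations in `S_n` without `Γ`-matches. -/
def NM {p : ℕ} (Γ : Finset (Equiv.Perm (Fin p))) (n : ℕ) : Finset (Equiv.Perm (Fin n)) :=
  {σ : Equiv.Perm (Fin n) | ∀ i : Fin n, ∀ τ ∈ Γ, ¬ IsMatch τ σ i}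

section Series

variable {K : Type*} [Field K]

/-- `[n]_q = 1 + q + ⋯ + q ^ (n - 1)`. -/
def qNat (q : K) (n : ℕ) : K := ∑ i ∈ range n, q ^ i

/-- `[n]_q! = [1]_q [2]_q ⋯ [n]_q`. -/
def qFactorial (q : K) (n : ℕ) : K := ∏ i ∈ range n, qNat q (i + 1)

/-- The `q`-binomial coefficient `[n]_q! / ([k]_q! [n - k]_q!)`, which is `0` for `k > n`. -/
def qBinom (q : K) (n k : ℕ) : K :=
  if k ≤ n then qFactorial q n / (qFactorial q k * qFactorial q (n - k)) else 0

/-- The formal power series `1 + ∑_{n ≥ 1} f n * t ^ n / [n]_q!` in the variable `t`. -/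
def qSeries (q : K) (f : ℕ → K) : PowerSeries K :=
  PowerSeries.mk fun n => if n = 0 then 1 else f n / qFactorial q n

/-- `INM_{Γ,n}(q, z)`, the sum of `z ^ (des σ + 1) * q ^ inv σ` over all `σ ∈ S_n` without
`Γ`-matches. -/
def INMcoeff {p : ℕ} (Γ : Finset (Equiv.Perm (Fin p))) (q z : K) (n : ℕ) : K :=
  ∑ σ ∈ NM Γ n, z ^ (des σ + 1) * q ^ inv σ

/-- `INM_Γ(t, q, z) = 1 + ∑_{n ≥ 1} INM_{Γ,n}(q, z) * t ^ n / [n]_q!`. -/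
def INM {p : ℕ} (Γ : Finset (Equiv.Perm (Fin p))) (q z : K) : PowerSeries K :=
  qSeries q (INMcoeff Γ q z)

/-- `IU_{Γ,n}(q, z)`: the coefficient of `t ^ n / [n]_q!` in the multiplicative inverse of the
power series `INM_Γ(t, q, z)`, whose constant term is `1`. -/
noncomputable def IUcoeff {p : ℕ} (Γ : Finset (Equiv.Perm (Fin p))) (q z : K) (n : ℕ) : K :=
  qFactorial q n * PowerSeries.coeff n (INM Γ q z)⁻¹

/-- `IU_Γ(t, q, z) = 1 + ∑_{n ≥ 1} IU_{Γ,n}(q, z) * t ^ n / [n]_q!`. -/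
noncomputable def IU {p : ℕ} (Γ : Finset (Equiv.Perm (Fin p))) (q z : K) : PowerSeries K :=
  qSeries q (IUcoeff Γ q z)

end Series

/-- The field `ℚ(q, z)` of rational functions in two indeterminates. -/
abbrev RatQZ : Type := FractionRing (MvPolynomial (Fin 2) ℚ)

/-- The indeterminate `q`. -/
noncomputable def qVar : RatQZ :=
  algebraMap (MvPolynomial (Fin 2) ℚ) RatQZ (MvPolynomial.X 0)

/-- The indeterminate `z`. -/
noncomputable def zVar : RatQZ :=
  algebraMap (MvPolynomial (Fin 2) ℚ) RatQZ (MvPolynomial.X 1)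

end ConsecutivePattern

/-!
Weight a word without `Γ`-matches by `z` to the number of its ascending runs, and a word covered by
a chain of ascents and `Γ`-matches, consecutive links of which share exactly one letter, by `-z`
times a factor `1 - z` for each ascent and `-z ^ des α` for each `α`-match. Since two `Γ`-matches
share at most one letter, these two weights are inverse to each other under deconcatenation, already
for each single word, if the empty chain is given weight `1`. Summation over all words, weighted by
`q` to the number of inversions, turns deconcatenation into the product of `q`-exponential series,
so that `IU_{Γ,n}` is the weighted sum of the chains of length `n`.

If all patterns start with `1`, then every chain starts with its smallest letter. Hence, if the
first link is an `α`-match and `s` is the last letter of `α`, then the `s` smallest letters all lie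
in that link. Its other `p - s` letters can be chosen freely among the remaining `n - s`, which is
counted by the `q`-binomial coefficient.
-/

namespace ConsecutivePattern

open Finset

/-! ### Words with distinct letters -/

section Arrangements

variable {α β M : Type*} [AddCommMonoid M] {S T : Finset α} {u v l : List α}

/-- The set of words in which each letter of `S` occurs exactly once and no other letter occurs.
These words play the role of permutations, with the advantage that prefixes and suffixes of such
words are again of this form. -/
def arrangements (S : Finset α) : Finset (List α) := ⟨S.val.lists, Multiset.lists_nodup_finset S⟩

theorem mem_arrangements : l ∈ arrangements S ↔ (l : Multiset α) = S.val := by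
  rw [arrangements, mem_mk, Multiset.mem_lists_iff, Multiset.quot_mk_to_coe, eq_comm]

theorem nodup_of_mem_arrangements (h : l ∈ arrangements S) : l.Nodup :=
  Multiset.coe_nodup.1 (mem_arrangements.1 h ▸ S.nodup)

theorem mem_iff_of_mem_arrangements (h : l ∈ arrangements S) {x : α} : x ∈ l ↔ x ∈ S := by
  rw [← mem_val, ← mem_arrangements.1 h, Multiset.mem_coe]

theorem length_of_mem_arrangements (h : l ∈ arrangements S) : l.length = #S :=
  congrArg Multiset.card (mem_arrangements.1 h)

theorem arrangements_empty : arrangements (∅ : Finset α) = {[]} := by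
  ext l
  simp [mem_arrangements]

theorem arrangements_singleton (x : α) : arrangements {x} = {[x]} := by
  ext l
  simp [mem_arrangements]

theorem append_mem_arrangements [DecidableEq α] (hTS : T ⊆ S) (hu : u ∈ arrangements T)
    (hv : v ∈ arrangements (S \ T)) : u ++ v ∈ arrangements S := by
  rw [mem_arrangements] at hu hv ⊢
  rw [← Multiset.coe_add, hu, hv, sdiff_val, add_tsub_cancel_of_le (val_le_iff.2 hTS)]

theorem drop_mem_arrangements_sdiff [DecidableEq α] (hl : l ∈ arrangements S) {k : ℕ}
    (htake : l.take k ∈ arrangements T) : l.drop k ∈ arrangements (S \ T) := by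
  rw [mem_arrangements] at hl htake ⊢
  rw [sdiff_val, ← hl, ← htake]
  refine eq_tsub_of_add_eq ?_
  rw [add_comm, Multiset.coe_add, List.take_append_drop]

theorem mem_arrangements_toFinset [DecidableEq α] (hl : l.Nodup) :
    l ∈ arrangements l.toFinset := by
  rw [mem_arrangements, List.toFinset_val, hl.dedup]

theorem toFinset_of_mem_arrangements [DecidableEq α] (hl : l ∈ arrangements S) :
    l.toFinset = S := by
  ext x
  rw [List.mem_toFinset, mem_iff_of_mem_arrangements hl]

theorem sum_arrangements_eq_sum_append [DecidableEq α] {k : ℕ} (hk : k ≤ #S) (f : List α → M) :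
    ∑ l ∈ arrangements S, f l =
      ∑ T ∈ powersetCard k S, ∑ u ∈ arrangements T, ∑ v ∈ arrangements (S \ T), f (u ++ v) := by
  simp_rw [sum_sigma']
  refine sum_nbij' (fun l => ⟨(l.take k).toFinset, l.take k, l.drop k⟩)
    (fun x => x.2.1 ++ x.2.2) ?_ ?_ ?_ ?_ ?_
  · intro l hl
    have htake : l.take k ∈ arrangements (l.take k).toFinset :=
      mem_arrangements_toFinset ((nodup_of_mem_arrangements hl).sublist (List.take_sublist k l))
    have hsub : (l.take k).toFinset ⊆ S := fun x hx =>
      (mem_iff_of_mem_arrangements hl).1 (List.mem_of_mem_take (List.mem_toFinset.1 hx))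
    have hcard : #(l.take k).toFinset = k := by
      rw [← length_of_mem_arrangements htake, List.length_take, length_of_mem_arrangements hl,
        min_eq_left hk]
    simp only [mem_sigma, mem_powersetCard]
    exact ⟨⟨hsub, hcard⟩, htake, drop_mem_arrangements_sdiff hl htake⟩
  · rintro ⟨T, u, v⟩ h
    simp only [mem_sigma, mem_powersetCard] at h
    exact append_mem_arrangements h.1.1 h.2.1 h.2.2
  · exact fun l _ => List.take_append_drop k l
  · rintro ⟨T, u, v⟩ h
    simp only [mem_sigma, mem_powersetCard] at h
    have hu : u.length = k := by rw [length_of_mem_arrangements h.2.1, h.1.2]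
    simp [← hu, toFinset_of_mem_arrangements h.2.1]
  · exact fun l _ => by rw [List.take_append_drop]

theorem arrangements_map (φ : α ↪ β) (S : Finset α) :
    arrangements (S.map φ) = (arrangements S).map ⟨List.map φ, List.map_injective_iff.2 φ.2⟩ := by
  ext l
  simp only [mem_map, Function.Embedding.coeFn_mk]
  constructor
  · intro h
    obtain ⟨l, rfl⟩ : l ∈ Set.range (List.map φ) := by
      rw [Set.range_list_map]
      intro x hx
      obtain ⟨y, -, rfl⟩ := mem_map.1 ((mem_iff_of_mem_arrangements h).1 hx)
      exact ⟨y, rfl⟩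
    rw [mem_arrangements, ← Multiset.map_coe, map_val] at h
    exact ⟨l, mem_arrangements.2 (Multiset.map_injective φ.2 h), rfl⟩
  · rintro ⟨l, h, rfl⟩
    rw [mem_arrangements] at h ⊢
    rw [← Multiset.map_coe, h, map_val]

theorem sum_arrangements_map (φ : α ↪ β) (S : Finset α) (f : List β → M) :
    ∑ l ∈ arrangements (S.map φ), f l = ∑ l ∈ arrangements S, f (l.map φ) := by
  rw [arrangements_map, sum_map]
  rfl

end Arrangements

theorem exists_orderEmbedding_map_range (S : Finset ℕ) :
    ∃ φ : ℕ ↪o ℕ, (range #S).map φ.toEmbedding = S := by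
  classical
  let P (x : ℕ) : Prop := x ∈ S ∨ S.sup id < x
  have hinf : {x | P x}.Infinite := (Set.Ioi_infinite (S.sup id)).mono fun x hx => Or.inr hx
  refine ⟨OrderEmbedding.ofStrictMono (Nat.nth P) (Nat.nth_strictMono hinf),
    (eq_of_subset_of_card_le (fun x hx => ?_) ?_).symm⟩
  · refine mem_map.2 ⟨Nat.count P x, mem_range.2 ?_, Nat.nth_count (Or.inl hx)⟩
    rw [Nat.count_eq_card_filter_range]
    refine card_lt_card ⟨fun y hy => ?_, fun h => ?_⟩
    · obtain ⟨hyx, hy⟩ := mem_filter.1 hy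
      exact hy.resolve_right ((mem_range.1 hyx).le.trans (le_sup (f := id) hx)).not_gt
    · exact lt_irrefl x (mem_range.1 (mem_filter.1 (h hx)).1)
  · rw [card_map, card_range]

theorem exists_map_eq_of_nodup {l : List ℕ} (hl : l.Nodup) :
    ∃ φ : ℕ ↪o ℕ, ∃ l' ∈ arrangements (range l.length), l'.map φ = l := by
  obtain ⟨φ, hφ⟩ := exists_orderEmbedding_map_range l.toFinset
  have hmem : l ∈ arrangements ((range l.length).map φ.toEmbedding) := by
    rw [← List.toFinset_card_of_nodup hl, hφ]
    exact mem_arrangements_toFinset hl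
  rw [arrangements_map] at hmem
  exact ⟨φ, mem_map.1 hmem⟩

/-- The functions on words that depend only on the relative order of the letters: they extend
functions of permutations to all words with distinct letters. -/
def OrderInvariant {M : Type*} (f : List ℕ → M) : Prop :=
  ∀ (φ : ℕ ↪o ℕ) (l : List ℕ), f (l.map φ) = f l

theorem OrderInvariant.sum_arrangements {M : Type*} [AddCommMonoid M] {f : List ℕ → M}
    (hf : OrderInvariant f) (S : Finset ℕ) :
    ∑ l ∈ arrangements S, f l = ∑ l ∈ arrangements (range #S), f l := by
  obtain ⟨φ, hφ⟩ := exists_orderEmbedding_map_range S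
  conv_lhs => rw [← hφ, sum_arrangements_map]
  exact sum_congr rfl fun l _ => hf φ l

/-! ### Inversions and ascending runs -/

section Statistics

variable {α : Type*} [LinearOrder α]

/-- The number of inversions of a word. -/
def wordInv : List α → ℕ
  | [] => 0
  | x :: l => l.countP (· < x) + wordInv l

/-- The number of maximal ascending runs of a word with distinct letters. For a nonempty word it is
one more than the number of descents, so that `runs` covers the exponent `des σ + 1` and the
constant term of `INM` alike. -/
def runs : List α → ℕ
  | [] => 0
  | [_] => 1
  | x :: y :: l => (if y < x then 1 else 0) + runs (y :: l)

/-- The number of inversions between the letters of `S` and those of `T`, in a word in which all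
letters of `S` precede all letters of `T`. -/
def crossInv (S T : Finset α) : ℕ := ∑ a ∈ S, #{b ∈ T | b < a}

theorem wordInv_append (u v : List α) :
    wordInv (u ++ v) = (u.map fun x => v.countP (· < x)).sum + wordInv u + wordInv v := by
  induction u with
  | nil => simp [wordInv]
  | cons x u ih =>
    simp only [List.cons_append, wordInv, List.countP_append, ih, List.map_cons, List.sum_cons]
    omega

theorem countP_lt_of_mem_arrangements {S : Finset α} {l : List α} (hl : l ∈ arrangements S)
    (x : α) : l.countP (· < x) = #{b ∈ S | b < x} := by
  rw [card_def, filter_val, ← Multiset.countP_eq_card_filter, ← mem_arrangements.1 hl,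
    Multiset.coe_countP]

theorem wordInv_append_of_mem_arrangements {S T : Finset α} {u v : List α}
    (hu : u ∈ arrangements S) (hv : v ∈ arrangements T) :
    wordInv (u ++ v) = crossInv S T + wordInv u + wordInv v := by
  simp_rw [wordInv_append, countP_lt_of_mem_arrangements hv]
  rw [crossInv, sum_eq_multiset_sum, ← mem_arrangements.1 hu, Multiset.map_coe, Multiset.sum_coe]

theorem runs_append_cons (u : List α) (x : α) (v : List α) :
    runs (u ++ x :: v) + 1 = runs (u ++ [x]) + runs (x :: v) := by
  induction u with
  | nil => simp [runs, add_comm]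
  | cons y u ih =>
    cases u with
    | nil => simp only [List.cons_append, List.nil_append, runs]; omega
    | cons y' u =>
      simp only [List.cons_append, runs] at ih ⊢
      omega

theorem runs_take_add_runs_drop {l : List α} {k : ℕ} (hk : k < l.length) :
    runs (l.take (k + 1)) + runs (l.drop k) = runs l + 1 := by
  rw [List.take_succ_eq_append_getElem hk, List.drop_eq_getElem_cons hk, ← runs_append_cons,
    ← List.drop_eq_getElem_cons, List.take_append_drop]

end Statistics

theorem orderInvariant_wordInv : OrderInvariant wordInv := by
  intro φ l
  induction l with
  | nil => rfl
  | cons x l ih => simp [wordInv, ih, List.countP_map, Function.comp_def, φ.lt_iff_lt]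

theorem orderInvariant_runs : OrderInvariant runs := by
  intro φ l
  induction l with
  | nil => rfl
  | cons x l ih =>
    cases l with
    | nil => rfl
    | cons y l =>
      simp only [List.map_cons, runs, φ.lt_iff_lt] at ih ⊢
      rw [ih]

/-! ### One-line notation -/

section OneLine

variable {n : ℕ}

/-- The one-line notation of a permutation, as a word in the letters `0, …, n - 1`. -/
def oneLine (σ : Equiv.Perm (Fin n)) : List ℕ := List.ofFn fun i => (σ i : ℕ)

theorem length_oneLine (σ : Equiv.Perm (Fin n)) : (oneLine σ).length = n := List.length_ofFn

theorem oneLine_injective : Function.Injective (oneLine (n := n)) := fun _ _ h =>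
  Equiv.ext fun i => Fin.ext (congrFun (List.ofFn_injective h) i)

theorem oneLine_mem_arrangements (σ : Equiv.Perm (Fin n)) :
    oneLine σ ∈ arrangements (range n) := by
  have hnodup : (oneLine σ).Nodup := List.nodup_ofFn.2 (Fin.val_injective.comp σ.injective)
  have hset : (oneLine σ).toFinset = range n := by
    ext x
    simp only [oneLine, List.mem_toFinset, List.mem_ofFn, mem_range]
    exact ⟨fun ⟨i, hi⟩ => hi ▸ (σ i).2, fun hx => ⟨σ.symm ⟨x, hx⟩, by simp⟩⟩
  exact hset ▸ mem_arrangements_toFinset hnodup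

theorem exists_oneLine_eq {l : List ℕ} (hl : l ∈ arrangements (range n)) :
    ∃ σ : Equiv.Perm (Fin n), oneLine σ = l := by
  obtain rfl : l.length = n := (length_of_mem_arrangements hl).trans (card_range n)
  have hlt (i : Fin l.length) : l[i] < l.length :=
    mem_range.1 ((mem_iff_of_mem_arrangements hl).1 (List.getElem_mem _))
  have hinj : Function.Injective fun i : Fin l.length => (⟨l[i], hlt i⟩ : Fin l.length) :=
    fun _ _ h => Fin.ext ((nodup_of_mem_arrangements hl).getElem_inj_iff.1 (Fin.mk.inj h))
  exact ⟨Equiv.ofBijective _ (Finite.injective_iff_bijective.1 hinj), List.ofFn_getElem⟩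

theorem sum_oneLine_eq_sum_arrangements {M : Type*} [AddCommMonoid M] (f : List ℕ → M) :
    ∑ σ : Equiv.Perm (Fin n), f (oneLine σ) = ∑ l ∈ arrangements (range n), f l :=
  sum_bij (fun σ _ => oneLine σ) (fun σ _ => oneLine_mem_arrangements σ)
    (fun _ _ _ _ h => oneLine_injective h)
    (fun _ hl => (exists_oneLine_eq hl).imp fun _ h => ⟨mem_univ _, h⟩) fun _ _ => rfl

theorem countP_ofFn {α : Type*} (f : Fin n → α) (P : α → Prop) [DecidablePred P] :
    (List.ofFn f).countP (fun x => P x) = ∑ i, if P (f i) then 1 else 0 := by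
  induction n with
  | zero => rfl
  | succ n ih =>
    rw [List.ofFn_succ, List.countP_cons, ih, Fin.sum_univ_succ, add_comm]
    simp only [decide_eq_true_eq]

theorem wordInv_ofFn {α : Type*} [LinearOrder α] (f : Fin n → α) :
    wordInv (List.ofFn f) = ∑ i, ∑ j, if i < j ∧ f j < f i then 1 else 0 := by
  induction n with
  | zero => rfl
  | succ n ih =>
    rw [List.ofFn_succ, wordInv, ih, countP_ofFn, Fin.sum_univ_succ]
    simp_rw [Fin.sum_univ_succ]
    simp

theorem wordInv_oneLine (σ : Equiv.Perm (Fin n)) : wordInv (oneLine σ) = inv σ := by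
  rw [inv, oneLine, wordInv_ofFn, card_filter, Fintype.sum_prod_type]
  simp

theorem runs_ofFn_succ {α : Type*} [LinearOrder α] (f : Fin (n + 1) → α) :
    runs (List.ofFn f) = (∑ i : Fin n, if f i.succ < f i.castSucc then 1 else 0) + 1 := by
  induction n with
  | zero => simp [runs]
  | succ n ih =>
    have htail := ih fun i => f i.succ
    rw [List.ofFn_succ] at htail
    rw [List.ofFn_succ, List.ofFn_succ, runs, htail, Fin.sum_univ_succ, ← add_assoc]
    rfl

theorem runs_oneLine (hn : 0 < n) (σ : Equiv.Perm (Fin n)) : runs (oneLine σ) = des σ + 1 := by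
  obtain ⟨n, rfl⟩ := Nat.exists_eq_add_one.2 hn
  rw [oneLine, runs_ofFn_succ, des, card_filter, Fin.sum_univ_castSucc]
  simp [Fin.succ]

end OneLine

/-! ### Matches in words -/

section Matches

variable {p n : ℕ} {τ : Equiv.Perm (Fin p)} {l : List ℕ}

theorem red_lt_red_iff {m : ℕ} (w : Fin m → ℕ) {a b : Fin m} :
    red w a < red w b ↔ w a < w b := by
  refine ⟨fun h => ?_, fun h => card_lt_card ⟨fun c hc => ?_, fun hsub => ?_⟩⟩
  · contrapose! h
    exact card_le_card (monotone_filter_right _ fun c _ hc => hc.trans_le h)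
  · exact mem_filter.2 ⟨mem_univ c, (mem_filter.1 hc).2.trans h⟩
  · exact lt_irrefl _ (mem_filter.1 (hsub (mem_filter.2 ⟨mem_univ a, h⟩))).2

theorem card_filter_perm_lt (τ : Equiv.Perm (Fin p)) (a : Fin p) :
    #{b | τ b < τ a} = (τ a : ℕ) := by
  have hmap : ({b | τ b < τ a} : Finset (Fin p)).map τ.toEmbedding = Iio (τ a) := by
    ext x
    simp
  rw [← card_map τ.toEmbedding, hmap, Fin.card_Iio]

theorem red_eq_iff {w : Fin p → ℕ} :
    (∀ a, red w a = (τ a : ℕ)) ↔ ∀ a b, w a < w b ↔ τ a < τ b := by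
  refine ⟨fun h a b => ?_, fun h a => ?_⟩
  · rw [Fin.lt_def, ← h a, ← h b, red_lt_red_iff]
  · simp_rw [red, h, card_filter_perm_lt]

/-- The word `l` has a `τ`-match in its first position. -/
def StartsWithMatch (τ : Equiv.Perm (Fin p)) (l : List ℕ) : Prop :=
  p ≤ l.length ∧ ∀ a b : Fin p, l.getD a 0 < l.getD b 0 ↔ τ a < τ b

instance : Decidable (StartsWithMatch τ l) := by
  unfold StartsWithMatch
  infer_instance

theorem StartsWithMatch.eq {τ' : Equiv.Perm (Fin p)} (h : StartsWithMatch τ l)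
    (h' : StartsWithMatch τ' l) : τ = τ' :=
  Equiv.ext fun a => Fin.ext ((red_eq_iff.2 h.2 a).symm.trans (red_eq_iff.2 h'.2 a))

theorem startsWithMatch_map (φ : ℕ ↪o ℕ) :
    StartsWithMatch τ (l.map φ) ↔ StartsWithMatch τ l := by
  unfold StartsWithMatch
  rw [List.length_map]
  refine and_congr_right fun h => forall₂_congr fun a b => ?_
  simp [List.getD_eq_getElem?_getD, a.2.trans_le h, b.2.trans_le h]

theorem startsWithMatch_take {k : ℕ} :
    StartsWithMatch τ (l.take k) ↔ p ≤ k ∧ StartsWithMatch τ l := by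
  unfold StartsWithMatch
  rw [List.length_take, le_min_iff, and_assoc]
  refine and_congr_right fun hk => and_congr_right fun _ => forall₂_congr fun a b => ?_
  simp [List.getD_eq_getElem?_getD, a.2.trans_le hk, b.2.trans_le hk]

theorem startsWithMatch_oneLine_iff {σ : Equiv.Perm (Fin p)} :
    StartsWithMatch τ (oneLine σ) ↔ σ = τ := by
  have hself : StartsWithMatch σ (oneLine σ) := by
    refine ⟨(length_oneLine σ).ge, fun a b => ?_⟩
    simp [oneLine, List.getD_eq_getElem?_getD]
  exact ⟨hself.eq, fun h => h ▸ hself⟩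

theorem startsWithMatch_one_cons_cons {x y : ℕ} :
    StartsWithMatch (1 : Equiv.Perm (Fin 2)) (x :: y :: l) ↔ x < y := by
  simp +contextual [StartsWithMatch, Fin.forall_fin_two, le_of_lt]

theorem isMatch_iff {σ : Equiv.Perm (Fin n)} {i : Fin n} :
    IsMatch τ σ i ↔ StartsWithMatch τ ((oneLine σ).drop i) := by
  have hlen : p ≤ ((oneLine σ).drop i).length ↔ (i : ℕ) + p ≤ n := by
    rw [List.length_drop, length_oneLine]
    have := i.2
    omega
  have hletter (h : (i : ℕ) + p ≤ n) (a : Fin p) :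
      ((oneLine σ).drop i).getD a 0 = (σ ⟨i + a, by omega⟩ : ℕ) := by
    have ha : (i : ℕ) + a < n := by omega
    simp [oneLine, List.getD_eq_getElem?_getD, ha]
  rw [StartsWithMatch, hlen, IsMatch, ← exists_prop]
  refine exists_congr fun h => ?_
  simp_rw [red_eq_iff, hletter h]

theorem StartsWithMatch.exists_take_eq_map (h : StartsWithMatch τ l) (hl : l.Nodup) :
    ∃ φ : ℕ ↪o ℕ, l.take p = (oneLine τ).map φ := by
  obtain ⟨φ, l', hl', heq⟩ := exists_map_eq_of_nodup (hl.sublist (List.take_sublist p l))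
  rw [List.length_take, min_eq_left h.1] at hl'
  obtain ⟨σ, rfl⟩ := exists_oneLine_eq hl'
  have hmatch := startsWithMatch_take.2 ⟨le_rfl, h⟩
  rw [← heq, startsWithMatch_map, startsWithMatch_oneLine_iff] at hmatch
  exact ⟨φ, hmatch ▸ heq.symm⟩

end Matches

section Overlap

variable {p i : ℕ} {α β : Equiv.Perm (Fin p)} {Γ : Finset (Equiv.Perm (Fin p))} {l : List ℕ}

/-- The patterns in `Γ` have length at least `2`, and any two matches of patterns in `Γ` that start
in different positions of a word share at most one letter. This is what minimal overlapping
amounts to for words, without the requirement that an overlap in one letter occurs. -/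
structure MinimalOverlappingSet (Γ : Finset (Equiv.Perm (Fin p))) : Prop where
  two_le : ∀ α ∈ Γ, 2 ≤ p
  le_add_one : ∀ α ∈ Γ, ∀ β ∈ Γ, ∀ (l : List ℕ) (i : ℕ), l.Nodup → 0 < i →
    StartsWithMatch α l → StartsWithMatch β (l.drop i) → p ≤ i + 1

theorem exists_perm_isMatch_iff (hl : l.Nodup) {n : ℕ} (hn : n ≤ l.length) :
    ∃ σ : Equiv.Perm (Fin n), ∀ {p : ℕ} (τ : Equiv.Perm (Fin p)) (i : Fin n),
      IsMatch τ σ i ↔ (i : ℕ) + p ≤ n ∧ StartsWithMatch τ (l.drop i) := by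
  obtain ⟨φ, l', hl', heq⟩ := exists_map_eq_of_nodup (hl.sublist (List.take_sublist n l))
  rw [List.length_take, min_eq_left hn] at hl'
  obtain ⟨σ, rfl⟩ := exists_oneLine_eq hl'
  refine ⟨σ, fun {p} τ i => ?_⟩
  rw [isMatch_iff, ← startsWithMatch_map φ, List.map_drop, heq, List.drop_take,
    startsWithMatch_take, Nat.le_sub_iff_add_le' i.2.le]

theorem MutuallyMinimalOverlapping.le_add_one (hαβ : MutuallyMinimalOverlapping α β)
    (hl : l.Nodup) (hα : StartsWithMatch α l) (hβ : StartsWithMatch β (l.drop i)) :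
    p ≤ i + 1 := by
  have hp : 3 ≤ p := hαβ.1.1
  have hlen : i + p ≤ l.length := by have := hβ.1; rw [List.length_drop] at this; omega
  obtain ⟨σ, hσ⟩ := exists_perm_isMatch_iff hl hlen
  have hmchα : 1 ≤ mch α σ := card_pos.2
    ⟨⟨0, by omega⟩, mem_filter.2 ⟨mem_univ _, (hσ α _).2 ⟨by simp, hα⟩⟩⟩
  have hmchβ : 1 ≤ mch β σ := card_pos.2
    ⟨⟨i, by omega⟩, mem_filter.2 ⟨mem_univ _, (hσ β _).2 ⟨le_rfl, hβ⟩⟩⟩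
  have := hαβ.2.2.2 ⟨σ, hmchα, hmchβ⟩
  omega

theorem MinimalOverlapping.le_add_one (hα : MinimalOverlapping α) (hl : l.Nodup) (hi : 0 < i)
    (h₀ : StartsWithMatch α l) (hαi : StartsWithMatch α (l.drop i)) : p ≤ i + 1 := by
  classical
  have hex : ∃ j, 0 < j ∧ StartsWithMatch α (l.drop j) := ⟨i, hi, hαi⟩
  -- Up to the end of the second match there are exactly two matches.
  obtain ⟨j, ⟨hj, hj'⟩, hmin⟩ : ∃ j, (0 < j ∧ StartsWithMatch α (l.drop j)) ∧
      ∀ m, 0 < m ∧ StartsWithMatch α (l.drop m) → j ≤ m :=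
    ⟨Nat.find hex, Nat.find_spec hex, fun m => Nat.find_min' hex⟩
  have hp : 3 ≤ p := hα.1
  have hlen : j + p ≤ l.length := by have := hj'.1; rw [List.length_drop] at this; omega
  obtain ⟨σ, hσ⟩ := exists_perm_isMatch_iff hl hlen
  have hmatches : ({m | IsMatch α σ m} : Finset (Fin (j + p))) =
      {⟨0, by omega⟩, ⟨j, by omega⟩} := by
    ext m
    simp only [mem_filter, mem_univ, true_and, mem_insert, mem_singleton, hσ, Fin.ext_iff]
    refine ⟨fun hm => ?_, ?_⟩
    · have := hm.1
      have := fun h => hmin m ⟨h, hm.2⟩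
      omega
    · rintro (h | h) <;> rw [h]
      exacts [⟨by omega, h₀⟩, ⟨le_rfl, hj'⟩]
  have hmch : mch α σ = 2 := by
    rw [mch, hmatches, card_pair]
    simpa [Fin.ext_iff] using hj.ne
  have := hα.2.2 ⟨σ, hmch⟩
  have := hmin i ⟨hi, hαi⟩
  omega

theorem minimalOverlappingSet_of_pairwise (hmin : ∀ α ∈ Γ, MinimalOverlapping α)
    (hmut : ∀ α ∈ Γ, ∀ β ∈ Γ, α ≠ β → MutuallyMinimalOverlapping α β) :
    MinimalOverlappingSet Γ where
  two_le α hα := by have := (hmin α hα).1; omega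
  le_add_one α hα β hβ l i hl hi hαl hβl := by
    by_cases hαβ : α = β
    · subst hαβ
      exact (hmin α hα).le_add_one hl hi hαl hβl
    · exact (hmut α hα β hβ hαβ).le_add_one hl hαl hβl

end Overlap

/-! ### Chains of matches -/

section Chains

variable {R : Type*} [CommRing R] {p : ℕ} {τ α : Equiv.Perm (Fin p)}
  {Γ : Finset (Equiv.Perm (Fin p))} {z : R} {f g h : List ℕ → R} {l : List ℕ}

/-- The deconcatenation product of two functions on words. -/
def conv (f g : List ℕ → R) (l : List ℕ) : R :=
  ∑ k ∈ range (l.length + 1), f (l.take k) * g (l.drop k)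

/-- The indicator function of the words that consist of one letter. -/
def letter (l : List ℕ) : R := if l.length = 1 then 1 else 0

/-- The weight of the words that arise by attaching a `τ`-match in front of a word of weight `f`,
whose first letter becomes the last letter of the match. -/
def link (τ : Equiv.Perm (Fin p)) (f : List ℕ → R) (l : List ℕ) : R :=
  if StartsWithMatch τ l then f (l.drop (p - 1)) else 0

/-- The weight of the words that arise by attaching an ascent, of weight `1 - z`, or an `α`-match
with `α ∈ Γ`, of weight `-z ^ des α`, in front of a word of weight `f`. Ascents enter as matches of
the identity in `S_2`. -/
def links (Γ : Finset (Equiv.Perm (Fin p))) (z : R) (f : List ℕ → R) (l : List ℕ) : R :=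
  (1 - z) * link (1 : Equiv.Perm (Fin 2)) f l - ∑ α ∈ Γ, z ^ des α * link α f l

/-- The total weight of a word as a chain of ascents and `Γ`-matches in which consecutive links
share one letter: the solution of `clusterWeight = -z * letter + links Γ z clusterWeight`. In the
last summand, `l.drop (p - 2)` is `(x :: l).drop (p - 1)`, in a form that makes the recursion
terminate for every `p`. -/
def clusterWeight (Γ : Finset (Equiv.Perm (Fin p))) (z : R) : List ℕ → R
  | [] => 0
  | x :: l => (if l = [] then -z else 0) +
      ((1 - z) * (if StartsWithMatch (1 : Equiv.Perm (Fin 2)) (x :: l) then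
          clusterWeight Γ z l else 0) -
        ∑ α ∈ Γ, z ^ des α * if StartsWithMatch α (x :: l) then
          clusterWeight Γ z (l.drop (p - 2)) else 0)
termination_by l => l.length

theorem clusterWeight_nil : clusterWeight Γ z [] = 0 := by rw [clusterWeight]

theorem clusterWeight_eq (hΓ : ∀ α ∈ Γ, 2 ≤ p) (l : List ℕ) :
    clusterWeight Γ z l = -z * letter l + links Γ z (clusterWeight Γ z) l := by
  cases l with
  | nil => simp [clusterWeight_nil, letter, links, link, StartsWithMatch]
  | cons x l =>
    have hlink : ∀ α ∈ Γ, link α (clusterWeight Γ z) (x :: l) =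
        if StartsWithMatch α (x :: l) then clusterWeight Γ z (l.drop (p - 2)) else 0 := by
      intro α hα
      obtain ⟨p, rfl⟩ := Nat.exists_eq_add_of_le' (hΓ α hα)
      rfl
    have hletter : -z * letter (x :: l) = if l = [] then -z else 0 := by simp [letter]
    rw [clusterWeight, links, hletter, sum_congr rfl fun α hα => by rw [← hlink α hα]]
    rfl

theorem conv_add : conv (f + g) h l = conv f h l + conv g h l := by
  simp [conv, add_mul, sum_add_distrib]

theorem conv_smul (c : R) : conv (c • f) g l = c * conv f g l := by
  simp [conv, mul_sum, mul_assoc]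

theorem conv_letter (hl : l ≠ []) : conv letter g l = g l.tail := by
  obtain ⟨x, l, rfl⟩ := List.exists_cons_of_ne_nil hl
  rw [conv, sum_eq_single_of_mem 1 (by simp)]
  · simp [letter]
  · intro k hk hk1
    rw [letter, List.length_take_of_le (mem_range_succ_iff.1 hk), if_neg hk1, zero_mul]

theorem conv_link (hf : f [] = 0) : conv (link τ f) g l = link τ (conv f g) l := by
  have hterm (k : ℕ) : link τ f (l.take k) =
      if StartsWithMatch τ l then f ((l.drop (p - 1)).take (k - (p - 1))) else 0 := by
    simp only [link, startsWithMatch_take, List.drop_take]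
    by_cases hk : p ≤ k
    · simp [hk]
    · have : k - (p - 1) = 0 := by omega
      simp [hk, this, hf]
  simp_rw [conv, hterm, link]
  split_ifs with hτ
  · have hlen : l.length + 1 = (p - 1) + ((l.drop (p - 1)).length + 1) := by
      have := hτ.1
      rw [List.length_drop]
      omega
    rw [hlen, sum_range_add, sum_eq_zero, zero_add]
    · simp [conv, List.drop_drop]
    · intro k hk
      have : k - (p - 1) = 0 := by have := mem_range.1 hk; omega
      simp [this, hf]
  · simp

theorem conv_links (hf : f [] = 0) : conv (links Γ z f) g l = links Γ z (conv f g) l := by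
  simp only [links, ← conv_link hf, conv, sub_mul, sum_sub_distrib, sum_mul, mul_sum, mul_assoc]
  rw [sum_comm]

theorem links_neg : links Γ z (-f) l = -links Γ z f l := by
  have hlink {p : ℕ} (τ : Equiv.Perm (Fin p)) : link τ (-f) l = -link τ f l := by
    unfold link
    split_ifs <;> simp
  simp only [links, hlink, mul_neg, sum_neg_distrib]
  ring

theorem links_congr (hΓ : ∀ α ∈ Γ, 2 ≤ p)
    (hfg : ∀ k, 0 < k → k < l.length → f (l.drop k) = g (l.drop k)) :
    links Γ z f l = links Γ z g l := by
  have hlink {p : ℕ} (hp : 2 ≤ p) (τ : Equiv.Perm (Fin p)) : link τ f l = link τ g l := by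
    unfold link
    split_ifs with hτ
    · exact hfg _ (by omega) (by have := hτ.1; omega)
    · rfl
  rw [links, links, hlink le_rfl, sum_congr rfl fun α hα => by rw [hlink (hΓ α hα)]]

/-- Attaching a link makes a word longer, so that an equation `f = h + links f` determines `f`. -/
theorem eq_of_eq_add_links (hΓ : ∀ α ∈ Γ, 2 ≤ p) {P : List ℕ → Prop}
    (hP : ∀ l k, P l → P (l.drop k)) (hf : ∀ l ≠ [], P l → f l = h l + links Γ z f l)
    (hg : ∀ l ≠ [], P l → g l = h l + links Γ z g l) :
    ∀ l ≠ [], P l → f l = g l := by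
  intro l hne hl
  induction hn : l.length using Nat.strong_induction_on generalizing l with
  | _ n ih =>
    rw [hf l hne hl, hg l hne hl]
    congr 1
    refine links_congr hΓ fun k hk hkl => ih _ ?_ (l.drop k) ?_ (hP l k hl) rfl
    · rw [List.length_drop]
      omega
    · rwa [Ne, List.drop_eq_nil_iff, not_le]

theorem orderInvariant_clusterWeight (hΓ : ∀ α ∈ Γ, 2 ≤ p) :
    OrderInvariant (clusterWeight Γ z) := by
  intro φ l
  by_cases hne : l = []
  · rw [hne, List.map_nil]
  have hlink {p : ℕ} (τ : Equiv.Perm (Fin p)) (l : List ℕ) :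
      link τ (clusterWeight Γ z) (l.map φ) = link τ (fun l => clusterWeight Γ z (l.map φ)) l := by
    simp only [link, startsWithMatch_map, List.map_drop]
  refine eq_of_eq_add_links hΓ (P := fun _ => True) (h := fun l => -z * letter l)
    (fun _ _ _ => trivial) (f := fun l => clusterWeight Γ z (l.map φ)) (fun l _ _ => ?_)
    (fun l _ _ => clusterWeight_eq hΓ l) l hne trivial
  simp only [clusterWeight_eq hΓ (l.map φ), letter, List.length_map, links, hlink]

/-- The first letter of the word is smaller than all others. -/
def StartsWithMin (l : List ℕ) : Prop := ∀ j, 0 < j → j < l.length → l.getD 0 0 < l.getD j 0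

theorem startsWithMin_cons {x : ℕ} : StartsWithMin (x :: l) ↔ ∀ y ∈ l, x < y := by
  rw [List.forall_mem_iff_getElem]
  constructor
  · intro h j hj
    simpa [List.getD_eq_getElem?_getD, hj] using h (j + 1) (by omega) (by simpa using hj)
  · rintro h (_ | j) hj hjl
    · exact absurd hj (lt_irrefl 0)
    · have hjl : j < l.length := by simpa using hjl
      simpa [List.getD_eq_getElem?_getD, hjl] using h j hjl

theorem StartsWithMatch.startsWithMin (hone : StartsWithOne τ) (hp : 2 ≤ p)
    (hτ : StartsWithMatch τ l) (hmin : StartsWithMin (l.drop (p - 1))) : StartsWithMin l := by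
  obtain ⟨hp0, hone⟩ := hone
  have hprefix (j : ℕ) (hj : 0 < j) (hjp : j < p) : l.getD 0 0 < l.getD j 0 := by
    refine (hτ.2 ⟨0, hp0⟩ ⟨j, hjp⟩).2 ?_
    have hne : τ ⟨j, hjp⟩ ≠ τ ⟨0, hp0⟩ := τ.injective.ne (by simpa using hj.ne')
    rw [Ne, Fin.ext_iff, hone] at hne
    rwa [Fin.lt_def, hone, Nat.pos_iff_ne_zero]
  intro j hj hjl
  by_cases hjp : j < p
  · exact hprefix j hj hjp
  · have hlast := hmin (j - (p - 1)) (by omega) (by rw [List.length_drop]; omega)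
    simp only [List.getD_eq_getElem?_getD, List.getElem?_drop, add_zero,
      show p - 1 + (j - (p - 1)) = j by omega] at hlast
    refine (hprefix (p - 1) (by omega) (by omega)).trans ?_
    simpa only [List.getD_eq_getElem?_getD] using hlast

theorem startsWithMin_of_clusterWeight_ne_zero (hΓ : ∀ α ∈ Γ, 2 ≤ p)
    (hone : ∀ α ∈ Γ, StartsWithOne α) (hl : clusterWeight Γ z l ≠ 0) : StartsWithMin l := by
  induction hn : l.length using Nat.strong_induction_on generalizing l with
  | _ n ih =>
    have hlink {p : ℕ} (hp : 2 ≤ p) {τ : Equiv.Perm (Fin p)} (hτ : StartsWithOne τ)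
        (h : link τ (clusterWeight Γ z) l ≠ 0) : StartsWithMin l := by
      obtain ⟨hmatch, h⟩ := ite_ne_right_iff.1 h
      refine hmatch.startsWithMin hτ hp (ih _ ?_ h rfl)
      have := hmatch.1
      rw [List.length_drop]
      omega
    rw [clusterWeight_eq hΓ, links] at hl
    by_contra hmin
    refine hl ?_
    have hletter : (letter l : R) = 0 := if_neg fun h => hmin fun j _ _ => by omega
    rw [hletter, not_not.1 fun h => hmin (hlink le_rfl ⟨two_pos, rfl⟩ h), sum_eq_zero]
    · ring
    · intro α hα
      rw [not_not.1 fun h => hmin (hlink (hΓ α hα) (hone α hα) h), mul_zero]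

end Chains

/-! ### Cancellation between chains and words without matches -/

section Cancellation

variable {R : Type*} [CommRing R] {p : ℕ} {τ α : Equiv.Perm (Fin p)}
  {Γ : Finset (Equiv.Perm (Fin p))} {z : R} {l : List ℕ}

/-- The word `l` has no `Γ`-matches. -/
def Avoids (Γ : Finset (Equiv.Perm (Fin p))) (l : List ℕ) : Prop :=
  ∀ i, ∀ τ ∈ Γ, ¬ StartsWithMatch τ (l.drop i)

open Classical in
/-- The weight that words have in the definition of `INM`. -/
noncomputable def avoidWeight (Γ : Finset (Equiv.Perm (Fin p))) (z : R) (l : List ℕ) : R :=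
  if Avoids Γ l then z ^ runs l else 0

theorem avoids_nil (hΓ : ∀ α ∈ Γ, 2 ≤ p) : Avoids Γ [] := by
  intro i τ hτ h
  have hp : p = 0 := by simpa using h.1
  exact absurd (hΓ τ hτ) (by omega)

theorem avoidWeight_nil (hΓ : ∀ α ∈ Γ, 2 ≤ p) : avoidWeight Γ z [] = 1 := by
  rw [avoidWeight, if_pos (avoids_nil hΓ), runs, pow_zero]

theorem avoids_iff_tail : Avoids Γ l ↔ (∀ τ ∈ Γ, ¬ StartsWithMatch τ l) ∧ Avoids Γ l.tail := by
  refine ⟨fun h => ⟨h 0, fun i => ?_⟩, fun h i => ?_⟩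
  · rw [← List.drop_one, List.drop_drop]
    exact h (1 + i)
  · cases i with
    | zero => exact h.1
    | succ i =>
      rw [add_comm, ← List.drop_drop, List.drop_one]
      exact h.2 i

theorem orderInvariant_avoidWeight : OrderInvariant (avoidWeight Γ z) := by
  intro φ l
  have hiff : Avoids Γ (l.map φ) ↔ Avoids Γ l :=
    forall_congr' fun i => by simp only [← List.map_drop, startsWithMatch_map]
  rw [avoidWeight, avoidWeight, propext hiff, orderInvariant_runs]

theorem StartsWithMatch.runs_eq (h : StartsWithMatch α l) (hp : 0 < p) (hl : l.Nodup) :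
    runs l = des α + runs (l.drop (p - 1)) := by
  have hsplit := runs_take_add_runs_drop (l := l) (k := p - 1) (by have := h.1; omega)
  obtain ⟨φ, htake⟩ := h.exists_take_eq_map hl
  rw [Nat.sub_add_cancel hp, htake, orderInvariant_runs, runs_oneLine hp] at hsplit
  omega

theorem MinimalOverlappingSet.avoids_tail_iff (hΓ : MinimalOverlappingSet Γ) (hα : α ∈ Γ)
    (hl : l.Nodup) (h : StartsWithMatch α l) :
    Avoids Γ l.tail ↔ Avoids Γ (l.drop (p - 1)) := by
  have hp := hΓ.two_le α hα
  simp only [Avoids, ← List.drop_one, List.drop_drop]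
  refine ⟨fun h' i => ?_, fun h' i τ hτ hi => ?_⟩
  · convert h' (p - 2 + i) using 5
    omega
  · have hpi := hΓ.le_add_one α hα τ hτ l (1 + i) hl (by omega) h hi
    refine h' (1 + i - (p - 1)) τ hτ ?_
    rwa [Nat.add_sub_cancel' (by omega)]

open Classical in
/-- The first term treats the first letter as a run of its own, and the second one corrects this if
`l` starts with an ascent. -/
theorem avoidWeight_tail_add_link (hΓ : ∀ α ∈ Γ, 2 ≤ p) (hl : l.Nodup) (hne : l ≠ []) :
    z * avoidWeight Γ z l.tail + (1 - z) * link (1 : Equiv.Perm (Fin 2)) (avoidWeight Γ z) l =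
      if Avoids Γ l.tail then z ^ runs l else 0 := by
  match l, hne with
  | [x], _ => simp [avoidWeight_nil hΓ, avoids_nil hΓ, link, StartsWithMatch, runs]
  | x :: y :: l, _ =>
    have hxy : x ≠ y := fun h => by simp [h] at hl
    simp only [link, startsWithMatch_one_cons_cons, avoidWeight, List.tail_cons, runs]
    rcases hxy.lt_or_gt with h | h <;> by_cases ha : Avoids Γ (y :: l) <;>
      simp [h, h.not_gt, ha, pow_add]
    ring

theorem avoidWeight_eq (hΓ : MinimalOverlappingSet Γ) (hl : l.Nodup) (hne : l ≠ []) :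
    avoidWeight Γ z l = z * avoidWeight Γ z l.tail + links Γ z (avoidWeight Γ z) l := by
  classical
  rw [links, ← add_sub_assoc, avoidWeight_tail_add_link hΓ.two_le hl hne, avoidWeight,
    avoids_iff_tail]
  by_cases hex : ∃ α ∈ Γ, StartsWithMatch α l
  · obtain ⟨α, hα, h⟩ := hex
    have hp := hΓ.two_le α hα
    have hsum : ∑ β ∈ Γ, z ^ des β * link β (avoidWeight Γ z) l =
        z ^ des α * avoidWeight Γ z (l.drop (p - 1)) := by
      rw [sum_eq_single_of_mem α hα fun β _ hβ => ?_, link, if_pos h]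
      rw [link, if_neg fun h' => hβ (h'.eq h), mul_zero]
    rw [hsum, if_neg fun h' => h'.1 α hα h, avoidWeight, hΓ.avoids_tail_iff hα hl h,
      h.runs_eq (by omega) hl]
    simp [pow_add]
  · push Not at hex
    have hsum : ∑ β ∈ Γ, z ^ des β * link β (avoidWeight Γ z) l = 0 :=
      sum_eq_zero fun β hβ => by rw [link, if_neg (hex β hβ), mul_zero]
    rw [hsum, sub_zero]
    simp only [and_iff_right hex]

theorem conv_clusterWeight_avoidWeight (hΓ : MinimalOverlappingSet Γ) (hl : l.Nodup)
    (hne : l ≠ []) : conv (clusterWeight Γ z) (avoidWeight Γ z) l = -avoidWeight Γ z l := by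
  refine eq_of_eq_add_links hΓ.two_le (z := z) (P := List.Nodup) (g := -avoidWeight Γ z)
    (h := fun l => -z * avoidWeight Γ z l.tail)
    (fun l k hl => hl.sublist (List.drop_sublist k l)) (fun l hne _ => ?_) (fun l hne hl => ?_)
    l hne hl
  · have hC : clusterWeight Γ z = (-z) • letter + links Γ z (clusterWeight Γ z) :=
      funext (clusterWeight_eq hΓ.two_le)
    conv_lhs => rw [hC]
    rw [conv_add, conv_smul, conv_letter hne, conv_links clusterWeight_nil]
  · rw [links_neg, Pi.neg_apply, avoidWeight_eq hΓ hl hne]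
    ring

end Cancellation

/-! ### Sums weighted by inversions -/

section WordSum

variable {K : Type*} [Field K] {q z : K} {f g : List ℕ → K} {k n : ℕ} {S : Finset ℕ}

/-- The sum of `f` over the words in the letters `0, …, n - 1`, weighted by inversions. -/
def wordSum (q : K) (f : List ℕ → K) (n : ℕ) : K :=
  ∑ l ∈ arrangements (range n), q ^ wordInv l * f l

theorem wordSum_zero : wordSum q f 0 = f [] := by
  simp [wordSum, arrangements_empty, wordInv]

theorem OrderInvariant.sum_pow_wordInv_mul (hf : OrderInvariant f) (S : Finset ℕ) :
    ∑ l ∈ arrangements S, q ^ wordInv l * f l = wordSum q f #S :=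
  OrderInvariant.sum_arrangements (fun φ l => by rw [orderInvariant_wordInv, hf]) S

theorem sum_pow_wordInv_mul_take_drop (hk : k ≤ #S) (F : List ℕ → List ℕ → K) :
    ∑ l ∈ arrangements S, q ^ wordInv l * F (l.take k) (l.drop k) =
      ∑ T ∈ powersetCard k S, q ^ crossInv T (S \ T) * ∑ u ∈ arrangements T,
        q ^ wordInv u * ∑ v ∈ arrangements (S \ T), q ^ wordInv v * F u v := by
  rw [sum_arrangements_eq_sum_append hk]
  simp_rw [mul_sum]
  refine sum_congr rfl fun T hT => sum_congr rfl fun u hu => sum_congr rfl fun v hv => ?_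
  have hlen : u.length = k := (length_of_mem_arrangements hu).trans (mem_powersetCard.1 hT).2
  rw [wordInv_append_of_mem_arrangements hu hv, List.take_left' hlen, List.drop_left' hlen]
  ring

theorem sum_pow_wordInv (S : Finset ℕ) : ∑ l ∈ arrangements S, q ^ wordInv l = qFactorial q #S := by
  induction hn : #S generalizing S with
  | zero => simp [card_eq_zero.1 hn, arrangements_empty, wordInv, qFactorial]
  | succ n ih =>
    have hsplit := sum_pow_wordInv_mul_take_drop (q := q) (S := range (n + 1)) (k := 1)
      (by simp) fun _ _ => 1
    have hinv : OrderInvariant fun l => q ^ wordInv l := fun φ l =>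
      congrArg (q ^ ·) (orderInvariant_wordInv φ l)
    simp only [mul_one, powersetCard_one, sum_map] at hsplit
    rw [hinv.sum_arrangements, hn, hsplit, qFactorial, prod_range_succ, ← qFactorial, qNat, mul_sum]
    refine sum_congr rfl fun x hx => ?_
    have hsmaller : ({b ∈ range (n + 1) \ {x} | b < x} : Finset ℕ) = range x := by
      have := mem_range.1 hx
      grind
    have hrest : #(range (n + 1) \ {x}) = n := by
      rw [card_sdiff_of_subset (singleton_subset_iff.2 hx), card_range, card_singleton,
        Nat.add_sub_cancel]
    simp [arrangements_singleton, crossInv, wordInv, hsmaller, ih _ hrest, mul_comm]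

theorem sum_pow_crossInv (hq : ∀ n, qFactorial q n ≠ 0) (S : Finset ℕ) (k : ℕ) :
    ∑ T ∈ powersetCard k S, q ^ crossInv T (S \ T) = qBinom q #S k := by
  by_cases hk : k ≤ #S
  · have hsplit := sum_pow_wordInv_mul_take_drop (q := q) hk fun _ _ => 1
    simp only [mul_one, sum_pow_wordInv, ← sum_mul] at hsplit
    rw [qBinom, if_pos hk, eq_div_iff (mul_ne_zero (hq _) (hq _)), hsplit, sum_mul]
    refine sum_congr rfl fun T hT => ?_
    obtain ⟨hTS, hTk⟩ := mem_powersetCard.1 hT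
    rw [card_sdiff_of_subset hTS, hTk]
  · rw [powersetCard_eq_empty.2 (not_le.1 hk), qBinom, if_neg hk, sum_empty]

theorem wordSum_conv (hq : ∀ n, qFactorial q n ≠ 0) (hf : OrderInvariant f)
    (hg : OrderInvariant g) (n : ℕ) :
    wordSum q (conv f g) n =
      ∑ k ∈ range (n + 1), qBinom q n k * (wordSum q f k * wordSum q g (n - k)) := by
  have hlength : ∀ l ∈ arrangements (range n), l.length = n := fun l hl => by
    rw [length_of_mem_arrangements hl, card_range]
  rw [wordSum, sum_congr rfl fun l hl => by rw [conv, hlength l hl, mul_sum], sum_comm]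
  refine sum_congr rfl fun k hk => ?_
  have hk : k ≤ #(range n) := by simpa using hk
  rw [sum_pow_wordInv_mul_take_drop hk fun u v => f u * g v]
  have hbinom := sum_pow_crossInv hq (range n) k
  rw [card_range] at hbinom
  rw [← hbinom, sum_mul]
  refine sum_congr rfl fun T hT => ?_
  obtain ⟨hTn, hTk⟩ := mem_powersetCard.1 hT
  have hrest : #(range n \ T) = n - k := by rw [card_sdiff_of_subset hTn, hTk, card_range]
  simp_rw [mul_left_comm _ (f _), ← mul_sum, hg.sum_pow_wordInv_mul, ← mul_assoc, ← sum_mul,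
    hf.sum_pow_wordInv_mul, hTk, hrest, mul_assoc]

/-- The exponential generating series of `wordSum q f`, with `q`-factorials. -/
def wordSeries (q : K) (f : List ℕ → K) : PowerSeries K :=
  PowerSeries.mk fun n => wordSum q f n / qFactorial q n

theorem wordSeries_conv (hq : ∀ n, qFactorial q n ≠ 0) (hf : OrderInvariant f)
    (hg : OrderInvariant g) : wordSeries q (conv f g) = wordSeries q f * wordSeries q g := by
  ext n
  simp only [wordSeries, PowerSeries.coeff_mul, PowerSeries.coeff_mk, wordSum_conv hq hf hg]
  rw [Nat.sum_antidiagonal_eq_sum_range_succ fun i j =>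
    wordSum q f i / qFactorial q i * (wordSum q g j / qFactorial q j), sum_div]
  refine sum_congr rfl fun k hk => ?_
  have := hq n
  have := hq k
  have := hq (n - k)
  rw [qBinom, if_pos (mem_range_succ_iff.1 hk)]
  field_simp

theorem qFactorial_zero : qFactorial q 0 = 1 := prod_range_zero _

theorem qSeries_eq_wordSeries {a : ℕ → K} (hf : f [] = 1)
    (ha : ∀ n, n ≠ 0 → a n = wordSum q f n) : qSeries q a = wordSeries q f := by
  ext n
  rw [qSeries, wordSeries, PowerSeries.coeff_mk, PowerSeries.coeff_mk]
  split_ifs with hn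
  · rw [hn, wordSum_zero, hf, qFactorial_zero, div_one]
  · rw [ha n hn]

variable {p : ℕ} {τ : Equiv.Perm (Fin p)} {Γ : Finset (Equiv.Perm (Fin p))}

theorem avoids_oneLine_iff (hΓ : ∀ α ∈ Γ, 2 ≤ p) {σ : Equiv.Perm (Fin n)} :
    Avoids Γ (oneLine σ) ↔ σ ∈ NM Γ n := by
  simp only [NM, mem_filter, mem_univ, true_and, isMatch_iff]
  refine ⟨fun h i => h i, fun h i τ hτ hi => ?_⟩
  have hlen := hi.1
  rw [List.length_drop, length_oneLine] at hlen
  exact h ⟨i, by have := hΓ τ hτ; omega⟩ τ hτ hi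

theorem INMcoeff_eq_wordSum (hΓ : ∀ α ∈ Γ, 2 ≤ p) (hn : n ≠ 0) :
    INMcoeff Γ q z n = wordSum q (avoidWeight Γ z) n := by
  rw [wordSum, ← sum_oneLine_eq_sum_arrangements, INMcoeff, ← univ_inter (NM Γ n), ← sum_ite_mem]
  refine sum_congr rfl fun σ _ => ?_
  simp only [avoidWeight, avoids_oneLine_iff hΓ, wordInv_oneLine,
    runs_oneLine (Nat.pos_of_ne_zero hn)]
  split_ifs <;> ring

theorem INM_eq_wordSeries (hΓ : ∀ α ∈ Γ, 2 ≤ p) :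
    INM Γ q z = wordSeries q (avoidWeight Γ z) :=
  qSeries_eq_wordSeries (avoidWeight_nil hΓ) fun _ => INMcoeff_eq_wordSum hΓ

theorem wordSeries_clusterWeight_mul_INM (hq : ∀ n, qFactorial q n ≠ 0)
    (hΓ : MinimalOverlappingSet Γ) :
    wordSeries q (clusterWeight Γ z) * INM Γ q z = 1 - INM Γ q z := by
  rw [INM_eq_wordSeries hΓ.two_le, ← wordSeries_conv hq (orderInvariant_clusterWeight hΓ.two_le)
    orderInvariant_avoidWeight]
  ext n
  simp only [wordSeries, map_sub, PowerSeries.coeff_mk, PowerSeries.coeff_one]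
  split_ifs with hn
  · simp [hn, wordSum_zero, qFactorial_zero, conv, clusterWeight_nil, avoidWeight_nil hΓ.two_le]
  · have hcancel : ∀ l ∈ arrangements (range n),
        conv (clusterWeight Γ z) (avoidWeight Γ z) l = -avoidWeight Γ z l := fun l hl =>
      conv_clusterWeight_avoidWeight hΓ (nodup_of_mem_arrangements hl) <|
        List.ne_nil_of_length_pos <| by
          rw [length_of_mem_arrangements hl, card_range]
          omega
    rw [wordSum, sum_congr rfl fun l hl => by rw [hcancel l hl, mul_neg], sum_neg_distrib,
      ← wordSum, neg_div, zero_sub]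

theorem one_add_wordSeries_clusterWeight_mul_INM (hq : ∀ n, qFactorial q n ≠ 0)
    (hΓ : MinimalOverlappingSet Γ) :
    (1 + wordSeries q (clusterWeight Γ z)) * INM Γ q z = 1 := by
  rw [add_mul, wordSeries_clusterWeight_mul_INM hq hΓ, one_mul, add_sub_cancel]

theorem constantCoeff_INM : PowerSeries.constantCoeff (INM Γ q z) = 1 := by
  simp [INM, qSeries]

theorem INM_inv (hq : ∀ n, qFactorial q n ≠ 0) (hΓ : MinimalOverlappingSet Γ) :
    (INM Γ q z)⁻¹ = 1 + wordSeries q (clusterWeight Γ z) :=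
  (PowerSeries.inv_eq_iff_mul_eq_one (by simp [constantCoeff_INM])).2
    (one_add_wordSeries_clusterWeight_mul_INM hq hΓ)

theorem IUcoeff_eq_wordSum (hq : ∀ n, qFactorial q n ≠ 0) (hΓ : MinimalOverlappingSet Γ)
    (hn : n ≠ 0) : IUcoeff Γ q z n = wordSum q (clusterWeight Γ z) n := by
  rw [IUcoeff, INM_inv hq hΓ, map_add, PowerSeries.coeff_one, if_neg hn, zero_add, wordSeries,
    PowerSeries.coeff_mk, mul_div_cancel₀ _ (hq n)]

theorem IU_eq_INM_inv (hq : ∀ n, qFactorial q n ≠ 0) : IU Γ q z = (INM Γ q z)⁻¹ := by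
  ext n
  rw [IU, qSeries, PowerSeries.coeff_mk]
  split_ifs with hn
  · simp [hn, constantCoeff_INM]
  · rw [IUcoeff, mul_div_cancel_left₀ _ (hq n)]

theorem INM_mul_IU (hq : ∀ n, qFactorial q n ≠ 0) : INM Γ q z * IU Γ q z = 1 := by
  rw [IU_eq_INM_inv hq, PowerSeries.mul_inv_cancel _ (by simp [constantCoeff_INM])]

/-! ### The recursion -/

theorem sum_pow_wordInv_mul_cons (hf : OrderInvariant f) (hmin : ∀ l, f l ≠ 0 → StartsWithMin l)
    (x : ℕ) (S : Finset ℕ) :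
    ∑ l ∈ arrangements S, q ^ wordInv l * f (x :: l) =
      if ∀ y ∈ S, x < y then wordSum q f (#S + 1) else 0 := by
  have hzero {y w : ℕ} {T : Finset ℕ} (hw : w ∈ T) (hwy : ¬y < w) :
      ∑ l ∈ arrangements T, q ^ wordInv l * f (y :: l) = 0 := by
    refine sum_eq_zero fun l hl => mul_eq_zero_of_right _ (not_not.1 fun hne => hwy ?_)
    exact startsWithMin_cons.1 (hmin _ hne) w ((mem_iff_of_mem_arrangements hl).2 hw)
  split_ifs with hx
  · have hxS : x ∉ S := fun h => lt_irrefl x (hx x h)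
    have hsplit := sum_pow_wordInv_mul_take_drop (q := q) (S := insert x S) (k := 1)
      (by simp [hxS]) fun u v => f (u ++ v)
    simp only [List.take_append_drop, hf.sum_pow_wordInv_mul, card_insert_of_notMem hxS,
      powersetCard_one, sum_map, Function.Embedding.coeFn_mk, arrangements_singleton,
      sum_singleton, List.singleton_append] at hsplit
    rw [hsplit, sum_eq_single_of_mem x (mem_insert_self x S)]
    · have hcross : crossInv {x} (insert x S \ {x}) = 0 := by
        simp only [crossInv, sum_singleton, card_eq_zero, filter_eq_empty_iff]
        grind
      have hrest : insert x S \ {x} = S := by grind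
      rw [hcross, hrest]
      simp [wordInv]
    · intro y hy hyx
      have hyS : y ∈ S := (mem_insert.1 hy).resolve_left hyx
      rw [hzero (w := x) (by grind) (hx y hyS).not_gt, mul_zero, mul_zero]
  · push Not at hx
    obtain ⟨y, hy, hyx⟩ := hx
    exact hzero hy hyx.not_gt

theorem link_map_oneLine_append (hp : 0 < p) (φ : ℕ ↪o ℕ) (σ : Equiv.Perm (Fin p))
    (v : List ℕ) :
    link τ f ((oneLine σ).map φ ++ v) = if σ = τ then f (φ (lastLetter τ - 1) :: v) else 0 := by
  have hlen : ((oneLine σ).map φ).length = p := by rw [List.length_map, length_oneLine]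
  have hmatch : StartsWithMatch τ ((oneLine σ).map φ ++ v) ↔ σ = τ := by
    have htake := startsWithMatch_take (τ := τ) (l := (oneLine σ).map φ ++ v) (k := p)
    rw [List.take_left' hlen, startsWithMatch_map, startsWithMatch_oneLine_iff] at htake
    rw [htake, and_iff_right le_rfl]
  have hlast : ((oneLine σ).map φ).drop (p - 1) = [φ (lastLetter σ - 1)] := by
    rw [List.drop_eq_getElem_cons (by omega), List.drop_eq_nil_of_le (by omega)]
    simp [oneLine, lastLetter, hp]
  simp only [link, hmatch]
  split_ifs with hστ
  · rw [List.drop_append_of_le_length (by omega), hlast, hστ, List.singleton_append]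
  · rfl

theorem sum_arrangements_link (hp : 0 < p) (φ : ℕ ↪o ℕ) (S : Finset ℕ) :
    ∑ u ∈ arrangements ((range p).map φ.toEmbedding), q ^ wordInv u *
        ∑ v ∈ arrangements S, q ^ wordInv v * link τ f (u ++ v) =
      q ^ inv τ * ∑ v ∈ arrangements S, q ^ wordInv v * f (φ (lastLetter τ - 1) :: v) := by
  simp only [sum_arrangements_map, ← sum_oneLine_eq_sum_arrangements,
    RelEmbedding.coe_toEmbedding]
  rw [sum_eq_single_of_mem τ (mem_univ τ)]
  · simp only [link_map_oneLine_append hp, if_true, orderInvariant_wordInv φ (oneLine τ),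
      wordInv_oneLine]
  · intro σ _ hσ
    simp only [link_map_oneLine_append hp, if_neg hσ, mul_zero, sum_const_zero]

theorem forall_sdiff_lt_iff {s : ℕ} {φ : ℕ ↪o ℕ} (hs : s < p)
    (hφ : (range p).map φ.toEmbedding ⊆ range n) :
    (∀ y ∈ range n \ (range p).map φ.toEmbedding, φ s < y) ↔
      range (s + 1) ⊆ (range p).map φ.toEmbedding := by
  have hle : s ≤ φ s := φ.strictMono.le_apply
  have hsn : φ s < n := mem_range.1 (hφ (mem_map_of_mem _ (mem_range.2 hs)))
  constructor
  · intro h y hy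
    by_contra hyφ
    have := mem_range.1 hy
    have := h y (mem_sdiff.2 ⟨mem_range.2 (by omega), hyφ⟩)
    omega
  · intro h y hy
    have hφs : φ s ≤ s := by
      by_contra! hlt
      have hsub : range (s + 1) ⊆ (range s).map φ.toEmbedding := by
        intro i hi
        obtain ⟨j, -, rfl⟩ := mem_map.1 (h hi)
        have : φ j < φ s := (Nat.lt_succ_iff.1 (mem_range.1 hi)).trans_lt hlt
        exact mem_map_of_mem _ (mem_range.2 (φ.lt_iff_lt.1 this))
      simpa using card_le_card hsub
    have : y ∉ range (s + 1) := fun hys => (mem_sdiff.1 hy).2 (h hys)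
    rw [mem_range] at this
    omega

theorem sum_pow_crossInv_of_subset (hq : ∀ n, qFactorial q n ≠ 0) {L : Finset ℕ} (hLS : L ⊆ S)
    (hL : ∀ x ∈ L, ∀ y ∈ S \ L, x < y) (hk : #L ≤ k) :
    ∑ T ∈ powersetCard k S with L ⊆ T, q ^ crossInv T (S \ T) =
      qBinom q (#S - #L) (k - #L) := by
  rw [← card_sdiff_of_subset hLS, ← sum_pow_crossInv hq]
  refine sum_nbij' (· \ L) (L ∪ ·) ?_ ?_ ?_ ?_ ?_
  · intro T hT
    simp only [mem_filter, mem_powersetCard] at hT ⊢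
    obtain ⟨⟨hTS, rfl⟩, hLT⟩ := hT
    exact ⟨sdiff_subset_sdiff hTS le_rfl, card_sdiff_of_subset hLT⟩
  · intro U hU
    obtain ⟨hUS, hUk⟩ := mem_powersetCard.1 hU
    have hdisj : Disjoint L U := disjoint_sdiff.mono_right hUS
    simp only [mem_filter, mem_powersetCard]
    refine ⟨⟨union_subset hLS (hUS.trans sdiff_subset), ?_⟩, subset_union_left⟩
    rw [card_union_of_disjoint hdisj, hUk, Nat.add_sub_cancel' hk]
  · exact fun T hT => union_sdiff_of_subset (mem_filter.1 hT).2
  · intro U hU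
    exact union_sdiff_cancel_left (disjoint_sdiff.mono_right (mem_powersetCard.1 hU).1)
  · intro T hT
    have hLT := (mem_filter.1 hT).2
    have hlow : crossInv L (S \ T) = 0 := sum_eq_zero fun x hx => by
      rw [card_eq_zero, filter_eq_empty_iff]
      exact fun y hy => (hL x hx y (sdiff_subset_sdiff le_rfl hLT hy)).not_gt
    have hsplit : crossInv (T \ L) (S \ T) + crossInv L (S \ T) = crossInv T (S \ T) :=
      sum_sdiff hLT
    rw [← hsplit, hlow, add_zero, sdiff_sdiff_sdiff_cancel_right hLT]

theorem wordSum_link (hq : ∀ n, qFactorial q n ≠ 0) (hf : OrderInvariant f)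
    (hmin : ∀ l, f l ≠ 0 → StartsWithMin l) (hp : 0 < p) (hpn : p ≤ n) :
    wordSum q (link τ f) n =
      q ^ inv τ * qBinom q (n - lastLetter τ) (p - lastLetter τ) * wordSum q f (n - p + 1) := by
  obtain ⟨s, hs, hτ⟩ : ∃ s < p, lastLetter τ = s + 1 :=
    ⟨τ ⟨p - 1, by omega⟩, Fin.is_lt _, by rw [lastLetter, dif_pos hp]⟩
  have hbinom := sum_pow_crossInv_of_subset (L := range (s + 1)) (S := range n) (k := p) hq
    (range_subset_range.2 (by omega)) (fun x hx y hy => by grind) (by simpa using hs)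
  rw [card_range, card_range] at hbinom
  have hsplit := sum_pow_wordInv_mul_take_drop (q := q) (S := range n) (k := p) (by simpa)
    fun u v => link τ f (u ++ v)
  simp only [List.take_append_drop] at hsplit
  rw [wordSum, hsplit, hτ, ← hbinom, sum_filter, mul_sum, sum_mul]
  refine sum_congr rfl fun T hT => ?_
  obtain ⟨hTn, hTp⟩ := mem_powersetCard.1 hT
  have hrest : #(range n \ T) = n - p := by rw [card_sdiff_of_subset hTn, hTp, card_range]
  obtain ⟨φ, hφ⟩ := exists_orderEmbedding_map_range T
  rw [hTp] at hφ
  have hprefix := sum_arrangements_link (q := q) (f := f) (τ := τ) hp φ (range n \ T)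
  have hlow := forall_sdiff_lt_iff (n := n) (φ := φ) hs (hφ ▸ hTn)
  rw [hφ] at hprefix hlow
  rw [hprefix, sum_pow_wordInv_mul_cons hf hmin, hτ, Nat.add_sub_cancel]
  simp only [hlow, hrest]
  split_ifs <;> ring

theorem wordSum_link_eq_zero (hnp : n < p) : wordSum q (link τ f) n = 0 := by
  refine sum_eq_zero fun l hl => mul_eq_zero_of_right _ (if_neg fun hτ => ?_)
  have hlen := hτ.1
  rw [length_of_mem_arrangements hl, card_range] at hlen
  omega

theorem wordSum_links : wordSum q (links Γ z f) n =
    (1 - z) * wordSum q (link (1 : Equiv.Perm (Fin 2)) f) n -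
      ∑ α ∈ Γ, z ^ des α * wordSum q (link α f) n := by
  simp only [wordSum, links, mul_sub, sum_sub_distrib, mul_sum, mul_left_comm (q ^ _)]
  rw [sum_comm (s := Γ)]

theorem wordSum_link_one (hq : ∀ n, qFactorial q n ≠ 0) (hf : OrderInvariant f)
    (hmin : ∀ l, f l ≠ 0 → StartsWithMin l) (hn : 2 ≤ n) :
    wordSum q (link (1 : Equiv.Perm (Fin 2)) f) n = wordSum q f (n - 1) := by
  have hinv : inv (1 : Equiv.Perm (Fin 2)) = 0 := rfl
  have hlast : lastLetter (1 : Equiv.Perm (Fin 2)) = 2 := rfl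
  have hbinom : qBinom q (n - 2) 0 = 1 := by
    rw [qBinom, if_pos (Nat.zero_le _), qFactorial_zero, one_mul, Nat.sub_zero, div_self (hq _)]
  rw [wordSum_link hq hf hmin two_pos hn, hinv, hlast, Nat.sub_self, hbinom,
    pow_zero, one_mul, one_mul, show n - 2 + 1 = n - 1 by omega]

theorem wordSum_clusterWeight (hΓ : ∀ α ∈ Γ, 2 ≤ p) (hn : 2 ≤ n) :
    wordSum q (clusterWeight Γ z) n = wordSum q (links Γ z (clusterWeight Γ z)) n := by
  refine sum_congr rfl fun l hl => ?_
  have hlen : l.length = n := by rw [length_of_mem_arrangements hl, card_range]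
  rw [clusterWeight_eq hΓ, letter, if_neg (by omega), mul_zero, zero_add]

theorem wordSum_clusterWeight_one : wordSum q (clusterWeight Γ z) 1 = -z := by
  simp [wordSum, arrangements_singleton, wordInv, clusterWeight]

theorem wordSum_clusterWeight_recursion (hq : ∀ n, qFactorial q n ≠ 0) (hΓ : ∀ α ∈ Γ, 2 ≤ p)
    (hone : ∀ α ∈ Γ, StartsWithOne α) (hn : 2 ≤ n) :
    wordSum q (clusterWeight Γ z) n = (1 - z) * wordSum q (clusterWeight Γ z) (n - 1) -
      if p ≤ n then
        ∑ α ∈ Γ, z ^ des α * q ^ inv α * qBinom q (n - lastLetter α) (p - lastLetter α) *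
          wordSum q (clusterWeight Γ z) (n - p + 1)
      else 0 := by
  have hinvariant : OrderInvariant (clusterWeight Γ z) := orderInvariant_clusterWeight hΓ
  have hmin (l : List ℕ) : clusterWeight Γ z l ≠ 0 → StartsWithMin l :=
    startsWithMin_of_clusterWeight_ne_zero hΓ hone
  rw [wordSum_clusterWeight hΓ hn, wordSum_links, wordSum_link_one hq hinvariant hmin hn]
  congr 1
  split_ifs with hpn
  · refine sum_congr rfl fun α hα => ?_
    rw [wordSum_link hq hinvariant hmin (by have := hΓ α hα; omega) hpn]
    ring
  · simp only [wordSum_link_eq_zero (not_le.1 hpn), mul_zero, sum_const_zero]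

end WordSum

theorem theorem5p2_general {K : Type*} [Field K] {p : ℕ} {Γ : Finset (Equiv.Perm (Fin p))}
    (hΓ : MinimalOverlappingSet Γ) (hone : ∀ α ∈ Γ, StartsWithOne α) {q : K}
    (hq : ∀ n, qFactorial q n ≠ 0) (z : K) :
    INM Γ q z * IU Γ q z = 1 ∧
    IUcoeff Γ q z 1 = -z ∧
    ∀ n : ℕ, 2 ≤ n →
      IUcoeff Γ q z n =
        (1 - z) * IUcoeff Γ q z (n - 1) -
          if p ≤ n then
            ∑ α ∈ Γ, z ^ des α * q ^ inv α *
              qBinom q (n - lastLetter α) (p - lastLetter α) * IUcoeff Γ q z (n - p + 1)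
          else 0 := by
  have hIU {n : ℕ} : n ≠ 0 → IUcoeff Γ q z n = wordSum q (clusterWeight Γ z) n :=
    IUcoeff_eq_wordSum hq hΓ
  refine ⟨INM_mul_IU hq, (hIU one_ne_zero).trans wordSum_clusterWeight_one, fun n hn => ?_⟩
  rw [hIU (by omega), hIU (n := n - 1) (by omega), hIU (n := n - p + 1) (by omega)]
  exact wordSum_clusterWeight_recursion hq hΓ.two_le hone hn

theorem qFactorial_qVar_ne_zero (n : ℕ) : qFactorial qVar n ≠ 0 := by
  refine prod_ne_zero_iff.2 fun m _ hm => ?_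
  have hpoly : (∑ i ∈ range (m + 1), MvPolynomial.X 0 ^ i : MvPolynomial (Fin 2) ℚ) = 0 := by
    refine (IsFractionRing.to_map_eq_zero_iff (K := RatQZ)).1 ?_
    rw [← hm, qNat, map_sum]
    simp only [map_pow, qVar]
  have heval := congrArg (MvPolynomial.eval 1) hpoly
  simp only [map_sum, map_pow, MvPolynomial.eval_X, Pi.one_apply, one_pow, sum_const, card_range,
    map_zero, nsmul_eq_mul, mul_one] at heval
  exact m.succ_ne_zero (Nat.cast_eq_zero.1 heval)

end ConsecutivePattern

open ConsecutivePattern in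
/-- In the recursion, the sum over `Γ` is absent for `n < p`, where its `q`-binomial coefficients
vanish by convention. -/
theorem theorem5p2 (p : ℕ) (Γ : Finset (Equiv.Perm (Fin p)))
    (hmin : ∀ α ∈ Γ, MinimalOverlapping α)
    (hone : ∀ α ∈ Γ, StartsWithOne α)
    (hmut : ∀ α ∈ Γ, ∀ β ∈ Γ, α ≠ β → MutuallyMinimalOverlapping α β) :
    INM Γ qVar zVar * IU Γ qVar zVar = 1 ∧
    IUcoeff Γ qVar zVar 1 = -zVar ∧
    ∀ n : ℕ, 2 ≤ n →
      IUcoeff Γ qVar zVar n =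
        (1 - zVar) * IUcoeff Γ qVar zVar (n - 1) -
          if p ≤ n then
            ∑ α ∈ Γ, zVar ^ des α * qVar ^ inv α *
              qBinom qVar (n - lastLetter α) (p - lastLetter α) *
              IUcoeff Γ qVar zVar (n - p + 1)
          else 0 :=
  theorem5p2_general (minimalOverlappingSet_of_pairwise hmin hmut) hone qFactorial_qVar_ne_zero zVar
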